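/- For a finite set $S$ of points of Euclidean space $\mathbb{R}^d$, let $R(S)$ be the Vietoris--Rips complex of $S$ at scale $1$, that is, the simplicial complex on the vertex set $S$ whose faces are the subsets of $S$ of diameter at most $1$. For a field $\mathbf{k}$, let $\tilde\beta_p(R(S);\mathbf{k}) = \dim_{\mathbf{k}} \tilde H_p(R(S);\mathbf{k})$ be its reduced Betti numbers, and put $$M_{p,d}(n) := \max\{\tilde\beta_p(R(S);\mathbf{k}) : S \subset \mathbb{R}^d,\ |S| \le n\}.$$ **Theorem.** For every integer $d \ge 0$ and every real $\delta > 0$ there is an integer $N$, depending only on $d$ and $\delta$, such that for every field $\mathbf{k}$ and every $n \ge N$, $$M_{2,d}(n) < \delta n^2 .$$ -/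

import Mathlib

noncomputable section

/-- The Vietoris-Rips complex `R^ε(S)` of a finite set `S` of points of a metric space: its faces
are the nonempty subsets of `S` of diameter at most `ε` (the empty face is left implicit). -/
def ripsComplex {E : Type*} [MetricSpace E] (ε : ℝ) (S : Finset E) :
    PreAbstractSimplicialComplex E where
  faces := {F | F.Nonempty ∧ F ⊆ S ∧ Metric.diam (F : Set E) ≤ ε}
  isRelLowerSet_faces := fun _ h => ⟨h.1, fun _ hba hb =>
    ⟨hb, hba.trans h.2.1, (Metric.diam_mono (Finset.coe_subset.2 hba)
      (Set.Finite.isBounded (Finset.finite_toSet _))).trans h.2.2⟩⟩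

namespace SimplicialHomology

/-- The quotient `Z / (B ∩ Z)` for subspaces `Z` and `B` of a vector space. -/
abbrev Subquotient {k M : Type*} [Field k] [AddCommGroup M] [Module k M]
    (Z B : Submodule k M) : Type _ :=
  Z ⧸ B.submoduleOf Z

theorem finrank_subquotient_add {k M : Type*} [Field k] [AddCommGroup M] [Module k M]
    (Z B : Submodule k M) [Module.Finite k Z] (h : B ≤ Z) :
    Module.finrank k (Subquotient Z B) + Module.finrank k B = Module.finrank k Z := by
  rw [← Submodule.finrank_quotient_add_finrank (B.submoduleOf Z),
    (Submodule.submoduleOfEquivOfLe h).finrank_eq]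

variable (k : Type*) [Field k] {V : Type*}

/-- The boundary map on tuples of vertices,
`∂ (v₀, …, v_m) = ∑ i, (-1)ⁱ (v₀, …, v_{i-1}, v_{i+1}, …, v_m)`.
For `m = 0` the target has the empty tuple as its only basis element, and `∂` is the
augmentation, so that the homology below is reduced. -/
def boundary (m : ℕ) : ((Fin (m + 1) → V) →₀ k) →ₗ[k] ((Fin m → V) →₀ k) :=
  Finsupp.linearCombination k
    fun σ => ∑ i : Fin (m + 1), (-1 : k) ^ (i : ℕ) • Finsupp.single (σ ∘ i.succAbove) 1

open Classical in
/-- The ordered simplicial `p`-chains of `K` with coefficients in `k`: linear combinations of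
tuples `(v₀, …, v_p)`, repetitions allowed, whose set of entries is a face of `K`. -/
def chains (K : PreAbstractSimplicialComplex V) (p : ℕ) : Submodule k ((Fin (p + 1) → V) →₀ k) :=
  Finsupp.supported k k {σ | Finset.univ.image σ ∈ K}

/-- The `p`-cycles of `K` (for `p = 0`: with respect to the augmentation). -/
def cycles (K : PreAbstractSimplicialComplex V) (p : ℕ) : Submodule k ((Fin (p + 1) → V) →₀ k) :=
  chains k K p ⊓ LinearMap.ker (boundary k p)

/-- The `p`-boundaries of `K`. -/
def boundaries (K : PreAbstractSimplicialComplex V) (p : ℕ) :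
    Submodule k ((Fin (p + 1) → V) →₀ k) :=
  (chains k K (p + 1)).map (boundary k (p + 1))

/-- The reduced simplicial homology `H̃_p(K; k)`: cycles modulo boundaries (every boundary is a
cycle by `boundaries_le_cycles` below). -/
abbrev ReducedHomology (K : PreAbstractSimplicialComplex V) (p : ℕ) : Type _ :=
  Subquotient (cycles k K p) (boundaries k K p)

/-- The reduced Betti number `β̃_p(K; k) = dim_k H̃_p(K; k)`. -/
def reducedBetti (K : PreAbstractSimplicialComplex V) (p : ℕ) : ℕ :=
  Module.finrank k (ReducedHomology k K p)

theorem boundary_single (m : ℕ) (σ : Fin (m + 1) → V) :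
    boundary k m (Finsupp.single σ 1) =
      ∑ i : Fin (m + 1), (-1 : k) ^ (i : ℕ) • Finsupp.single (σ ∘ i.succAbove) 1 := by
  simp [boundary]

/-- Prepending a vertex to a tuple, extended linearly. -/
def cone (v : V) (m : ℕ) : ((Fin m → V) →₀ k) →ₗ[k] ((Fin (m + 1) → V) →₀ k) :=
  Finsupp.lmapDomain k k fun σ => (Fin.cons v σ : Fin (m + 1) → V)

theorem boundary_cone (v : V) (m : ℕ) (x : (Fin (m + 1) → V) →₀ k) :
    boundary k (m + 1) (cone k v (m + 1) x) = x - cone k v m (boundary k m x) := by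
  induction x using Finsupp.induction_linear with
  | zero => simp
  | add f g hf hg => rw [map_add, map_add, hf, hg, map_add, map_add]; abel
  | single σ a =>
    have h : Finsupp.single σ a = a • Finsupp.single σ (1 : k) := by simp
    rw [h]
    simp only [map_smul]
    rw [← smul_sub]
    congr 1
    have h1 : cone k v (m + 1) (Finsupp.single σ 1) =
        Finsupp.single (Fin.cons v σ : Fin (m + 2) → V) 1 := by simp [cone]
    rw [h1, boundary_single, boundary_single, Fin.sum_univ_succ, map_sum, sub_eq_add_neg,
      ← Finset.sum_neg_distrib]
    congr 1
    · have : (Fin.cons v σ : Fin (m + 2) → V) ∘ Fin.succAbove 0 = σ := by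
        funext j; simp
      rw [this]; simp
    · refine Finset.sum_congr rfl fun i _ => ?_
      have : (Fin.cons v σ : Fin (m + 2) → V) ∘ i.succ.succAbove =
          (Fin.cons v (σ ∘ i.succAbove) : Fin (m + 1) → V) := by
        funext j
        refine Fin.cases ?_ (fun j => ?_) j <;> simp
      rw [this]
      simp [cone, pow_succ]

theorem boundary_boundary (m : ℕ) (x : (Fin (m + 2) → V) →₀ k) :
    boundary k m (boundary k (m + 1) x) = 0 := by
  induction m with
  | zero =>
    induction x using Finsupp.induction_linear with
    | zero => simp
    | add f g hf hg => rw [map_add, map_add, hf, hg, add_zero]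
    | single σ a =>
      have h : Finsupp.single σ a = a • Finsupp.single σ (1 : k) := by simp
      rw [h, map_smul, map_smul, boundary_single, map_sum]
      simp only [map_smul, boundary_single]
      rw [Fin.sum_univ_two]
      have h0 (f g : Fin 0 → V) : f = g := Subsingleton.elim f g
      rw [Fin.sum_univ_one, Fin.sum_univ_one,
        h0 ((σ ∘ Fin.succAbove 0) ∘ Fin.succAbove 0) ((σ ∘ Fin.succAbove 1) ∘ Fin.succAbove 0)]
      simp
  | succ m ih =>
    induction x using Finsupp.induction_linear with
    | zero => simp
    | add f g hf hg => rw [map_add, map_add, hf, hg, add_zero]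
    | single σ a =>
      have h : Finsupp.single σ a =
          cone k (σ 0) (m + 2) (Finsupp.single (Fin.tail σ) a) := by simp [cone]
      rw [h, boundary_cone, map_sub, boundary_cone, ih]
      simp

theorem boundary_mem_chains (K : PreAbstractSimplicialComplex V) (p : ℕ)
    {x : (Fin (p + 2) → V) →₀ k} (hx : x ∈ chains k K (p + 1)) :
    boundary k (p + 1) x ∈ chains k K p := by
  classical
  rw [boundary, Finsupp.linearCombination_apply, Finsupp.sum]
  refine Submodule.sum_mem _ fun σ hσ => Submodule.smul_mem _ _ (Submodule.sum_mem _ fun i _ =>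
    Submodule.smul_mem _ _ (Finsupp.single_mem_supported k _ ?_))
  have h : Finset.univ.image σ ∈ K := by
    have := (Finsupp.mem_supported k x).1 hx hσ
    simp only [Set.mem_ofPred_eq] at this
    convert this
  have h2 : Finset.univ.image (σ ∘ i.succAbove) ∈ K := by
    refine (K.isRelLowerSet_faces h).2 ?_ (Finset.univ_nonempty.image _)
    intro y hy
    simp only [Finset.mem_image, Finset.mem_univ, true_and, Function.comp_apply] at hy ⊢
    obtain ⟨j, rfl⟩ := hy
    exact ⟨_, rfl⟩
  simp only [Set.mem_ofPred_eq]
  convert h2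

/-- Every boundary is a cycle. -/
theorem boundaries_le_cycles (K : PreAbstractSimplicialComplex V) (p : ℕ) :
    boundaries k K p ≤ cycles k K p := by
  rintro _ ⟨x, hx, rfl⟩
  exact ⟨boundary_mem_chains k K p hx, boundary_boundary k p x⟩

/-- The chains of a complex with finitely many vertices are finite dimensional. -/
theorem finite_chains (K : PreAbstractSimplicialComplex V) (S : Finset V)
    (hK : ∀ F ∈ K, F ⊆ S) (p : ℕ) :
    Module.Finite k (chains k K p) ∧ Module.finrank k (chains k K p) ≤ S.card ^ (p + 1) := by
  classical
  have hle : chains k K p ≤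
      Finsupp.supported k k (Fintype.piFinset fun _ : Fin (p + 1) => S : Set (Fin (p + 1) → V)) := by
    refine Finsupp.supported_mono fun σ hσ => ?_
    simp only [Finset.mem_coe, Fintype.mem_piFinset]
    intro i
    exact hK _ hσ (by simp)
  let T := Fintype.piFinset fun _ : Fin (p + 1) => S
  have e := Finsupp.supportedEquivFinsupp (M := k) (R := k) (T : Set (Fin (p + 1) → V))
  have : Module.Finite k (Finsupp.supported k k (T : Set (Fin (p + 1) → V))) :=
    Module.Finite.equiv e.symm
  refine ⟨Submodule.finiteDimensional_of_le hle, (Submodule.finrank_mono hle).trans ?_⟩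
  rw [e.finrank_eq]
  simp [T]

theorem reducedBetti_add_finrank_boundaries (K : PreAbstractSimplicialComplex V) (S : Finset V)
    (hK : ∀ F ∈ K, F ⊆ S) (p : ℕ) :
    reducedBetti k K p + Module.finrank k (boundaries k K p) = Module.finrank k (cycles k K p) := by
  have h1 := (finite_chains k K S hK p).1
  have h3 : Module.Finite k (cycles k K p) := Submodule.finiteDimensional_of_le inf_le_left
  exact finrank_subquotient_add _ _ (boundaries_le_cycles k K p)

theorem reducedBetti_le (K : PreAbstractSimplicialComplex V) (S : Finset V)
    (hK : ∀ F ∈ K, F ⊆ S) (p : ℕ) : reducedBetti k K p ≤ S.card ^ (p + 1) := by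
  obtain ⟨h1, h2⟩ := finite_chains k K S hK p
  have h3 : Module.finrank k (cycles k K p) ≤ Module.finrank k (chains k K p) :=
    Submodule.finrank_mono inf_le_left
  have h4 := reducedBetti_add_finrank_boundaries k K S hK p
  lia

end SimplicialHomology

/-- `M_{p,d}(n)`, over the field `k`: the largest `β̃_p(R(S); k)` of a set `S` of at most `n`
points of Euclidean `d`-space, where `R(S) = R^1(S)`. -/
def maxRipsBetti (k : Type*) [Field k] (p d n : ℕ) : ℕ :=
  sSup {b | ∃ S : Finset (EuclideanSpace ℝ (Fin d)), S.card ≤ n ∧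
    SimplicialHomology.reducedBetti k (ripsComplex 1 S) p = b}

/-- The supremum that defines `M_{p,d}(n)` is a maximum. -/
theorem isGreatest_maxRipsBetti (k : Type*) [Field k] (p d n : ℕ) :
    IsGreatest {b | ∃ S : Finset (EuclideanSpace ℝ (Fin d)), S.card ≤ n ∧
      SimplicialHomology.reducedBetti k (ripsComplex 1 S) p = b} (maxRipsBetti k p d n) := by
  have hb : BddAbove {b | ∃ S : Finset (EuclideanSpace ℝ (Fin d)), S.card ≤ n ∧
      SimplicialHomology.reducedBetti k (ripsComplex 1 S) p = b} := by
    refine ⟨n ^ (p + 1), ?_⟩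
    rintro _ ⟨S, hS, rfl⟩
    exact (SimplicialHomology.reducedBetti_le k (ripsComplex 1 S) S (fun _ hF => hF.2.1) p).trans
      (Nat.pow_le_pow_left hS _)
  exact ⟨Nat.sSup_mem ⟨_, ∅, by simp, rfl⟩ hb, fun b h => le_csSup hb h⟩

end

/-!
The Rips complex of `S` is the flag complex of the graph `G` on `S` that joins points at distance at
most `1`. Colour the points by cubes of side `1 / (d + 1)`, with the cube indices taken modulo
`2 * d + 3`. There are boundedly many colours, and neighbours of a common vertex that have the same
colour are adjacent (`isLocalCliqueColoring_cubeColoring`). The rest of the argument uses only this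
property, which survives the deletion of bichromatic edges.

Deleting an edge `vw` lowers the second Betti number by at most `β̃₀` of the link of `vw`, which is
the flag complex of the common neighbours of `v` and `w`
(`reducedBetti_flagComplex_le_deleteEdges`, from the Mayer-Vietoris bound `reducedBetti_union_le`).
The link is covered by one clique for each colour, so this costs at most the number of colours, and
it costs nothing if the link is connected. One may thus delete such edges for free until all
bichromatic edges that are left satisfy `IsSeparating`, a condition implied by the disconnectedness
of a nonempty link. A graph without bichromatic edges gives a disjoint union of simplices, so `β̃₂`
is at most the number of colours times the number of bichromatic edges that are left, and it is
enough to show that there are `o(n²)` of them (`exists_card_bichromaticEdges_le`).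

Fix the colours of `v` and `w`. The edges `vw` whose link has no edge between these two colours lie
on no four-cycle of such edges, so there are `O(n^(3/2))` of them. For any other `vw`, the vertices
of the link with these colours are in one component, and some vertex `y` of the link is adjacent to
none of them. Then `v` is the only vertex of its colour adjacent to both `w` and `y`, and `w` is
the only one of its colour adjacent to both `v` and `y`. So the triangles `vwy` are edge-disjoint,
and their edges form no other triangle. By the triangle removal lemma there are `o(n²)` such
triangles (the Ruzsa-Szemerédi bound `exists_card_le_of_explicitDisjoint`).
-/

/-! ### Betti numbers of unions and cones -/

namespace SimplicialHomology

/-- A subspace of `Z` that complements `B ∩ Z` in `Z` and has the dimension of the subquotient. -/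
theorem exists_complement_subquotient {k M : Type*} [Field k] [AddCommGroup M] [Module k M]
    (Z B : Submodule k M) :
    ∃ W ≤ Z, Module.finrank k W = Module.finrank k (Subquotient Z B) ∧ Z ≤ B ⊔ W := by
  obtain ⟨C, hC⟩ := Submodule.exists_isCompl (B.submoduleOf Z)
  refine ⟨C.map Z.subtype, Submodule.map_subtype_le _ _, ?_, ?_⟩
  · rw [(Submodule.quotientEquivOfIsCompl _ _ hC).finrank_eq]
    exact (Submodule.equivMapOfInjective _ Z.injective_subtype C).finrank_eq.symm
  · intro z hz
    have : (⟨z, hz⟩ : Z) ∈ B.submoduleOf Z ⊔ C := by rw [hC.sup_eq_top]; trivial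
    obtain ⟨b, hb, c, hc, h⟩ := Submodule.mem_sup.1 this
    exact Submodule.mem_sup.2 ⟨b, hb, c, ⟨c, hc, rfl⟩, congrArg Subtype.val h⟩

/-- If a linear map on `Z` is such that its kernel lies in `Z₁ + Z₂`, then `Z / B` is no larger than
`Z₁ / B₁`, `Z₂ / B₂` and the target together. -/
theorem finrank_subquotient_le {k M Q : Type*} [Field k] [AddCommGroup M] [Module k M]
    [AddCommGroup Q] [Module k Q] [Module.Finite k Q] {Z B Z₁ B₁ Z₂ B₂ : Submodule k M}
    [Module.Finite k Z] [Module.Finite k Z₁] [Module.Finite k Z₂] (hB : B ≤ Z) (hB₁ : B₁ ≤ B)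
    (hB₂ : B₂ ≤ B) (f : Z →ₗ[k] Q) (hf : ∀ z, f z = 0 → (z : M) ∈ Z₁ ⊔ Z₂) :
    Module.finrank k (Subquotient Z B) ≤ Module.finrank k (Subquotient Z₁ B₁) +
      Module.finrank k (Subquotient Z₂ B₂) + Module.finrank k Q := by
  obtain ⟨W₁, hW₁, hd₁, hc₁⟩ := exists_complement_subquotient Z₁ B₁
  obtain ⟨W₂, hW₂, hd₂, hc₂⟩ := exists_complement_subquotient Z₂ B₂
  have fB : Module.Finite k B := Submodule.finiteDimensional_of_le hB
  have fW₁ : Module.Finite k W₁ := Submodule.finiteDimensional_of_le hW₁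
  have fW₂ : Module.Finite k W₂ := Submodule.finiteDimensional_of_le hW₂
  have hker : (LinearMap.ker f).map Z.subtype ≤ B ⊔ (W₁ ⊔ W₂) := by
    rintro _ ⟨z, hz, rfl⟩
    exact sup_le (hc₁.trans (sup_le_sup hB₁ le_sup_left))
      (hc₂.trans (sup_le_sup hB₂ le_sup_right)) (hf z hz)
  have e1 := LinearMap.finrank_range_add_finrank_ker f
  have e2 : Module.finrank k (LinearMap.range f) ≤ Module.finrank k Q := Submodule.finrank_le _
  have e3 : Module.finrank k (LinearMap.ker f) ≤ Module.finrank k ↥(B ⊔ (W₁ ⊔ W₂)) := by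
    rw [← Submodule.finrank_map_subtype_eq]
    exact Submodule.finrank_mono hker
  have e4 := Submodule.finrank_add_le_finrank_add_finrank B (W₁ ⊔ W₂)
  have e5 := Submodule.finrank_add_le_finrank_add_finrank W₁ W₂
  have e6 := finrank_subquotient_add Z B hB
  omega

variable (k : Type*) [Field k] {V : Type*}

open Classical in
theorem mem_chains_iff (K : PreAbstractSimplicialComplex V) (p : ℕ) (x : (Fin (p + 1) → V) →₀ k) :
    x ∈ chains k K p ↔ ∀ σ, x σ ≠ 0 → Finset.univ.image σ ∈ K := by
  rw [chains, Finsupp.mem_supported]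
  simp [Set.subset_def]

theorem chains_mono {K L : PreAbstractSimplicialComplex V} (h : ∀ F ∈ K, F ∈ L) (p : ℕ) :
    chains k K p ≤ chains k L p := by
  intro x hx
  rw [mem_chains_iff] at hx ⊢
  exact fun σ hσ => h _ (hx σ hσ)

theorem boundaries_mono {K L : PreAbstractSimplicialComplex V} (h : ∀ F ∈ K, F ∈ L) (p : ℕ) :
    boundaries k K p ≤ boundaries k L p :=
  Submodule.map_mono (chains_mono k h (p + 1))

theorem finite_cycles (K : PreAbstractSimplicialComplex V) (S : Finset V)
    (hK : ∀ F ∈ K, F ⊆ S) (p : ℕ) : Module.Finite k (cycles k K p) :=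
  have := (finite_chains k K S hK p).1
  Submodule.finiteDimensional_of_le inf_le_left

theorem reducedBetti_eq_zero {K : PreAbstractSimplicialComplex V} {p : ℕ}
    (h : cycles k K p ≤ boundaries k K p) : reducedBetti k K p = 0 := by
  have : Subsingleton (ReducedHomology k K p) := by
    exact Submodule.Quotient.subsingleton_iff.2 (Submodule.submoduleOf_eq_top.2 h)
  exact Module.finrank_zero_of_subsingleton

/-- The part of the Mayer-Vietoris sequence that bounds the homology of a union `M = K ∪ L` with
`N = K ∩ L`. A cycle `z` of `M` is the sum of its restriction `x` to the tuples that span a face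
of `K` and of a chain of `L`. The class of `∂x` in the homology of `N` depends linearly on `z`, and
where it vanishes, `z` is a sum of a cycle of `K` and a cycle of `L`. -/
theorem reducedBetti_union_le {K L M N : PreAbstractSimplicialComplex V} (S : Finset V)
    (hS : ∀ F ∈ M, F ⊆ S) (hM : ∀ F, F ∈ M ↔ F ∈ K ∨ F ∈ L) (hN : ∀ F, F ∈ N ↔ F ∈ K ∧ F ∈ L)
    (p : ℕ) :
    reducedBetti k M (p + 1) ≤
      reducedBetti k K (p + 1) + reducedBetti k L (p + 1) + reducedBetti k N p := by
  classical
  have hKM : ∀ F ∈ K, F ∈ M := fun F hF => (hM F).2 (Or.inl hF)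
  have hLM : ∀ F ∈ L, F ∈ M := fun F hF => (hM F).2 (Or.inr hF)
  have hNK : ∀ F ∈ N, F ∈ K := fun F hF => ((hN F).1 hF).1
  have hNL : ∀ F ∈ N, F ∈ L := fun F hF => ((hN F).1 hF).2
  have fM := finite_cycles k M S hS (p + 1)
  have fK := finite_cycles k K S (fun F hF => hS F (hKM F hF)) (p + 1)
  have fL := finite_cycles k L S (fun F hF => hS F (hLM F hF)) (p + 1)
  have fN := finite_cycles k N S (fun F hF => hS F (hKM F (hNK F hF))) p
  let π : ((Fin (p + 2) → V) →₀ k) →ₗ[k] ((Fin (p + 2) → V) →₀ k) :=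
    Submodule.subtype _ ∘ₗ Finsupp.restrictDom k k {σ | Finset.univ.image σ ∈ K}
  have hπ (z : (Fin (p + 2) → V) →₀ k) (σ) :
      π z σ = if Finset.univ.image σ ∈ K then z σ else 0 := by
    simp [π, Finsupp.restrictDom_apply, Finsupp.filter_apply]
  have hπK (z) : π z ∈ chains k K (p + 1) := by
    rw [mem_chains_iff]
    intro σ hσ
    rw [hπ] at hσ
    convert (ite_ne_right_iff.1 hσ).1
  have hπL {z} (hz : z ∈ chains k M (p + 1)) : z - π z ∈ chains k L (p + 1) := by
    rw [mem_chains_iff] at hz ⊢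
    intro σ hσ
    rw [Finsupp.sub_apply, hπ] at hσ
    by_cases hK : Finset.univ.image σ ∈ K
    · simp [hK] at hσ
    · rw [if_neg hK, sub_zero] at hσ
      rcases (hM _).1 (hz σ hσ) with h | h
      · exact absurd (by convert h) hK
      · exact h
  have hinf {q : ℕ} {x : (Fin (q + 1) → V) →₀ k} (h1 : x ∈ chains k K q) (h2 : x ∈ chains k L q) :
      x ∈ chains k N q := by
    rw [mem_chains_iff] at h1 h2 ⊢
    exact fun σ hσ => (hN _).2 ⟨h1 σ hσ, h2 σ hσ⟩
  have hmem (z : cycles k M (p + 1)) : boundary k (p + 1) (π z) ∈ cycles k N p := by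
    refine ⟨hinf (boundary_mem_chains k K p (hπK _)) ?_, boundary_boundary k p _⟩
    have h : boundary k (p + 1) (π z) = - boundary k (p + 1) ((z : _ →₀ k) - π z) := by
      rw [map_sub, LinearMap.mem_ker.1 z.2.2]; simp
    rw [h]
    exact neg_mem (boundary_mem_chains k L p (hπL z.2.1))
  let f : cycles k M (p + 1) →ₗ[k] ReducedHomology k N p :=
    Submodule.mkQ _ ∘ₗ LinearMap.codRestrict (cycles k N p)
      (boundary k (p + 1) ∘ₗ π ∘ₗ Submodule.subtype _) hmem
  refine finrank_subquotient_le (boundaries_le_cycles k M (p + 1)) (boundaries_mono k hKM _)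
    (boundaries_mono k hLM _) f fun z hz => ?_
  have hz' : boundary k (p + 1) (π z) ∈ boundaries k N p := by
    simp only [f, LinearMap.comp_apply, Submodule.mkQ_apply, Submodule.Quotient.mk_eq_zero] at hz
    exact hz
  obtain ⟨u, hu, hu'⟩ := hz'
  have hzM := LinearMap.mem_ker.1 z.2.2
  have h1 : π z - u ∈ cycles k K (p + 1) :=
    ⟨sub_mem (hπK _) (chains_mono k hNK _ hu), by simp [hu']⟩
  have h2 : (z : _ →₀ k) - π z + u ∈ cycles k L (p + 1) :=
    ⟨add_mem (hπL z.2.1) (chains_mono k hNL _ hu), by simp [hu', hzM]⟩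
  exact Submodule.mem_sup.2 ⟨_, h1, _, h2, by abel⟩

/-- A disjoint union of cones has no homology in positive degrees: `r v` is the apex of the cone
that contains the vertex `v`. The contracting homotopy prepends to each tuple the apex that belongs
to its first vertex. -/
theorem reducedBetti_succ_eq_zero_of_apex {K : PreAbstractSimplicialComplex V} [DecidableEq V]
    (r : V → V) (hr : ∀ F ∈ K, ∀ v ∈ F, insert (r v) F ∈ K)
    (hc : ∀ F ∈ K, ∀ v ∈ F, ∀ w ∈ F, r v = r w) (p : ℕ) : reducedBetti k K (p + 1) = 0 := by
  let h (m : ℕ) : ((Fin (m + 1) → V) →₀ k) →ₗ[k] ((Fin (m + 2) → V) →₀ k) :=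
    Finsupp.lmapDomain k k fun σ => (Fin.cons (r (σ 0)) σ : Fin (m + 2) → V)
  have hs (m : ℕ) (σ : Fin (m + 1) → V) :
      h m (Finsupp.single σ 1) = Finsupp.single (Fin.cons (r (σ 0)) σ) 1 := by simp [h]
  refine reducedBetti_eq_zero k fun x hx => ?_
  have hx1 := (mem_chains_iff k K (p + 1) x).1 hx.1
  have key : ∀ y ∈ chains k K (p + 1),
      boundary k (p + 2) (h (p + 1) y) = y - h p (boundary k (p + 1) y) := by
    intro y hy
    rw [chains, Finsupp.supported_eq_span_single] at hy
    induction hy using Submodule.span_induction with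
    | mem y hy =>
      obtain ⟨σ, hσ, rfl⟩ := hy
      rw [Set.mem_ofPred_eq] at hσ
      have hσ : Finset.univ.image σ ∈ K := by convert hσ
      have h1 : h (p + 1) (Finsupp.single σ 1) =
          cone k (r (σ 0)) (p + 2) (Finsupp.single σ 1) := by simp [hs, cone]
      rw [h1, boundary_cone, boundary_single, map_sum, map_sum]
      congr 1
      refine Finset.sum_congr rfl fun i _ => ?_
      rw [map_smul, map_smul, hs, hc _ hσ ((σ ∘ i.succAbove) 0) (by simp) (σ 0) (by simp)]
      simp [cone]
    | zero => simp
    | add a b _ _ ha hb => simp only [map_add, ha, hb]; abel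
    | smul c a _ ha => simp only [map_smul, ha, smul_sub]
  have hb := key x hx.1
  rw [LinearMap.mem_ker.1 hx.2, map_zero, sub_zero] at hb
  refine ⟨h (p + 1) x, (mem_chains_iff k K (p + 2) _).2 fun σ hσ => ?_, hb⟩
  have : σ ∈ (h (p + 1) x).support := Finsupp.mem_support_iff.2 hσ
  rw [Finsupp.lmapDomain_apply] at this
  obtain ⟨τ, hτ, rfl⟩ := Finset.mem_image.1 (Finsupp.mapDomain_support this)
  have h2 := hx1 τ (Finsupp.mem_support_iff.1 hτ)
  have h3 := hr (Finset.univ.image τ) (by convert h2) (τ 0) (by simp)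
  convert h3
  ext a
  simp [Fin.exists_fin_succ, eq_comm]

end SimplicialHomology

/-! ### Reduced homology in degree zero -/

namespace SimplicialHomology

variable (k : Type*) [Field k] {V : Type*}

theorem single_sub_single_mem_boundaries [DecidableEq V] {K : PreAbstractSimplicialComplex V}
    {a b : V} (h : {a, b} ∈ K) :
    (Finsupp.single (fun _ => a) 1 - Finsupp.single (fun _ => b) 1 : (Fin 1 → V) →₀ k) ∈
      boundaries k K 0 := by
  refine ⟨Finsupp.single ![b, a] 1, (mem_chains_iff k K 1 _).2 fun σ hσ => ?_, ?_⟩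
  · obtain ⟨rfl, -⟩ := Finsupp.single_apply_ne_zero.1 hσ
    convert h
    ext x
    simp [Fin.exists_fin_two, or_comm, eq_comm]
  · rw [boundary_single, Fin.sum_univ_two]
    have h0 : ![b, a] ∘ Fin.succAbove 0 = fun _ => a := by
      funext i; fin_cases i; rfl
    have h1 : ![b, a] ∘ Fin.succAbove 1 = fun _ => b := by
      funext i; fin_cases i; rfl
    rw [h0, h1]
    simp [sub_eq_add_neg]

/-- If the vertices of `K` are labelled in such a way that vertices with the same label are
homologous, then a `0`-chain with coefficient sum zero in each label class is a boundary. -/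
theorem mem_boundaries_zero_of_mapDomain_eq_zero {ι : Type*} {K : PreAbstractSimplicialComplex V}
    (f : (Fin 1 → V) → ι)
    (hf : ∀ a b, {a} ∈ K → {b} ∈ K → f (fun _ => a) = f (fun _ => b) →
      (Finsupp.single (fun _ => a) 1 - Finsupp.single (fun _ => b) 1 : (Fin 1 → V) →₀ k) ∈
        boundaries k K 0)
    {x : (Fin 1 → V) →₀ k} (hx : x ∈ chains k K 0) (h0 : Finsupp.mapDomain f x = 0) :
    x ∈ boundaries k K 0 := by
  classical
  have hconst (σ : Fin 1 → V) : σ = fun _ => σ 0 := by funext i; rw [Subsingleton.elim i 0]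
  have himg (σ : Fin 1 → V) : Finset.univ.image σ = {σ 0} := by simp
  rw [mem_chains_iff] at hx
  rcases eq_or_ne x 0 with rfl | hne
  · exact zero_mem _
  obtain ⟨σ₀, -⟩ := Finsupp.ne_iff.1 hne
  have : Nonempty (Fin 1 → V) := ⟨σ₀⟩
  let T : Set (Fin 1 → V) := {σ | {σ 0} ∈ K}
  let g : ι → (Fin 1 → V) := Function.invFunOn f T
  have hT {σ} (hσ : x σ ≠ 0) : σ ∈ T := by
    have h := hx σ hσ
    change {σ 0} ∈ K
    convert h
    exact (himg σ).symm
  have hsum : x = x.sum fun σ a =>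
      a • (Finsupp.single σ (1 : k) - Finsupp.single (g (f σ)) 1) := by
    have h1 : Finsupp.mapDomain (g ∘ f) x = 0 := by
      rw [Finsupp.mapDomain_comp, h0, Finsupp.mapDomain_zero]
    rw [Finsupp.mapDomain] at h1
    simp only [smul_sub, Finsupp.smul_single, smul_eq_mul, mul_one]
    rw [Finsupp.sum_sub, Finsupp.sum_single]
    simp only [Function.comp_apply] at h1
    rw [h1, sub_zero]
  rw [hsum]
  refine Submodule.sum_mem _ fun σ hσ => Submodule.smul_mem _ _ ?_
  have hσT := hT (Finsupp.mem_support_iff.1 hσ)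
  have hex : ∃ τ ∈ T, f τ = f σ := ⟨σ, hσT, rfl⟩
  have hgT : g (f σ) ∈ T := Function.invFunOn_mem hex
  have hgf : f (g (f σ)) = f σ := Function.invFunOn_eq hex
  have := hf (σ 0) (g (f σ) 0) hσT hgT (by rw [← hconst, ← hconst, hgf])
  rwa [← hconst, ← hconst] at this

theorem reducedBetti_zero_le_card {ι : Type*} [Fintype ι] {K : PreAbstractSimplicialComplex V}
    (S : Finset V) (hS : ∀ F ∈ K, F ⊆ S) (f : V → ι)
    (hf : ∀ a b, {a} ∈ K → {b} ∈ K → f a = f b →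
      (Finsupp.single (fun _ => a) 1 - Finsupp.single (fun _ => b) 1 : (Fin 1 → V) →₀ k) ∈
        boundaries k K 0) :
    reducedBetti k K 0 ≤ Fintype.card ι := by
  have fK := finite_cycles k K S hS 0
  have fB : Module.Finite k (boundaries k K 0) :=
    Submodule.finiteDimensional_of_le (boundaries_le_cycles k K 0)
  have h := finrank_subquotient_le (Z₁ := boundaries k K 0) (B₁ := boundaries k K 0)
    (Z₂ := boundaries k K 0) (B₂ := boundaries k K 0) (boundaries_le_cycles k K 0) le_rfl le_rfl
    (Finsupp.lmapDomain k k (fun σ : Fin 1 → V => f (σ 0)) ∘ₗ Submodule.subtype _)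
    fun z hz => le_sup_left (a := boundaries k K 0)
      (mem_boundaries_zero_of_mapDomain_eq_zero k (fun σ => f (σ 0)) hf z.2.1 hz)
  have h0 := finrank_subquotient_add (boundaries k K 0) (boundaries k K 0) le_rfl
  rw [Module.finrank_finsupp_self] at h
  change reducedBetti k K 0 ≤ _ at h
  omega

theorem reducedBetti_zero_eq_zero {K : PreAbstractSimplicialComplex V}
    (hf : ∀ a b, {a} ∈ K → {b} ∈ K →
      (Finsupp.single (fun _ => a) 1 - Finsupp.single (fun _ => b) 1 : (Fin 1 → V) →₀ k) ∈
        boundaries k K 0) :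
    reducedBetti k K 0 = 0 := by
  refine reducedBetti_eq_zero k fun x hx => ?_
  refine mem_boundaries_zero_of_mapDomain_eq_zero k (fun σ => σ ∘ Fin.succAbove 0)
    (fun a b ha hb _ => hf a b ha hb) hx.1 ?_
  have h := LinearMap.mem_ker.1 hx.2
  simpa [boundary, Finsupp.linearCombination_apply, Finsupp.mapDomain] using h

end SimplicialHomology

/-! ### Flag complexes and the deletion of an edge -/

open SimplicialHomology

/-- The flag complex of the graph that `G` induces on the finite set `S`: its faces are the nonempty
cliques of `G` in `S`. -/
def flagComplex {V : Type*} (G : SimpleGraph V) (S : Finset V) :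
    PreAbstractSimplicialComplex V where
  faces := {F | F.Nonempty ∧ F ⊆ S ∧ ∀ x ∈ F, ∀ y ∈ F, x ≠ y → G.Adj x y}
  isRelLowerSet_faces := fun _ h => ⟨h.1, fun _ hba hb =>
    ⟨hb, hba.trans h.2.1, fun x hx y hy => h.2.2 x (hba hx) y (hba hy)⟩⟩

theorem mem_flagComplex {V : Type*} {G : SimpleGraph V} {S F : Finset V} :
    F ∈ flagComplex G S ↔ F.Nonempty ∧ F ⊆ S ∧ ∀ x ∈ F, ∀ y ∈ F, x ≠ y → G.Adj x y := Iff.rfl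

/-- The faces of `K` that satisfy a condition `P` inherited by subsets. -/
def PreAbstractSimplicialComplex.restrict {V : Type*} (K : PreAbstractSimplicialComplex V)
    (P : Finset V → Prop) (hP : ∀ E F, E ⊆ F → P F → P E) : PreAbstractSimplicialComplex V where
  faces := {F | F ∈ K ∧ P F}
  isRelLowerSet_faces := fun _ h => ⟨(K.isRelLowerSet_faces h.1).1, fun _ hba hb =>
    ⟨(K.isRelLowerSet_faces h.1).2 hba hb, hP _ _ hba h.2⟩⟩

open Classical in
/-- The vertices in `S` of the link of the edge `vw`: the common neighbours of `v` and `w`. -/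
noncomputable def linkVertices {V : Type*} (G : SimpleGraph V) (S : Finset V) (v w : V) :
    Finset V :=
  {x ∈ S | G.Adj v x ∧ G.Adj w x}

theorem mem_linkVertices {V : Type*} {G : SimpleGraph V} {S : Finset V} {v w x : V} :
    x ∈ linkVertices G S v w ↔ x ∈ S ∧ G.Adj v x ∧ G.Adj w x := by
  simp [linkVertices]

/-- The flag complex of `G` is the union of the one without the edge `vw` and of the star of `vw`,
which is a cone. These meet in the suspension of the link of `vw`, that is, in the union of two
cones over the link, with apices `v` and `w`. -/
theorem reducedBetti_flagComplex_le_deleteEdges (k : Type*) [Field k] {V : Type*}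
    {G : SimpleGraph V} {S : Finset V} {v w : V} (hv : v ∈ S) (hw : w ∈ S) (hvw : G.Adj v w)
    (p : ℕ) :
    reducedBetti k (flagComplex G S) (p + 2) ≤
      reducedBetti k (flagComplex (G.deleteEdges {s(v, w)}) S) (p + 2) +
        reducedBetti k (flagComplex G (linkVertices G S v w)) p := by
  classical
  have hne := hvw.ne
  have hwv := hvw.symm
  let P (F : Finset V) : Prop := ∀ x ∈ F, (x ≠ v → G.Adj v x) ∧ (x ≠ w → G.Adj w x)
  have hP : ∀ E F, E ⊆ F → P F → P E := fun E F h hF x hx => hF x (h hx)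
  let star := (flagComplex G S).restrict P hP
  let susp := star.restrict (fun F => v ∉ F ∨ w ∉ F) (fun E F h hF => by grind)
  let coneV := star.restrict (fun F => w ∉ F) (fun E F h hF => by grind)
  let coneW := star.restrict (fun F => v ∉ F) (fun E F h hF => by grind)
  have hstar (F) : F ∈ star ↔ F ∈ flagComplex G S ∧ P F := Iff.rfl
  have hcV (F) : F ∈ coneV ↔ F ∈ star ∧ w ∉ F := Iff.rfl
  have hcW (F) : F ∈ coneW ↔ F ∈ star ∧ v ∉ F := Iff.rfl
  have hsusp (F) : F ∈ susp ↔ F ∈ star ∧ (v ∉ F ∨ w ∉ F) := Iff.rfl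
  have hadj (x y) : (G.deleteEdges {s(v, w)}).Adj x y ↔
      G.Adj x y ∧ ¬ (x = v ∧ y = w ∨ x = w ∧ y = v) := by
    simp [SimpleGraph.deleteEdges_adj]
  have hdel (F) : F ∈ flagComplex (G.deleteEdges {s(v, w)}) S ↔
      F ∈ flagComplex G S ∧ (v ∉ F ∨ w ∉ F) := by
    simp only [mem_flagComplex, hadj]
    grind
  have hinsv (F) (hF : F ∈ star) : insert v F ∈ star := by
    simp only [hstar, mem_flagComplex, P] at hF ⊢
    refine ⟨⟨by simp, ?_, ?_⟩, ?_⟩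
    · grind
    · grind [SimpleGraph.adj_comm]
    · grind
  have hinsw (F) (hF : F ∈ star) : insert w F ∈ star := by
    simp only [hstar, mem_flagComplex, P] at hF ⊢
    refine ⟨⟨by simp, ?_, ?_⟩, ?_⟩
    · grind
    · grind [SimpleGraph.adj_comm]
    · grind
  have b1 : reducedBetti k star (p + 2) = 0 :=
    reducedBetti_succ_eq_zero_of_apex k (fun _ => v) (fun F hF _ _ => hinsv F hF)
      (fun _ _ _ _ _ _ => rfl) (p + 1)
  have b2 : reducedBetti k coneV (p + 1) = 0 :=
    reducedBetti_succ_eq_zero_of_apex k (fun _ => v)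
      (fun F hF _ _ => (hcV _).2 ⟨hinsv F hF.1, by have := hF.2; grind⟩)
      (fun _ _ _ _ _ _ => rfl) p
  have b3 : reducedBetti k coneW (p + 1) = 0 :=
    reducedBetti_succ_eq_zero_of_apex k (fun _ => w)
      (fun F hF _ _ => (hcW _).2 ⟨hinsw F hF.1, by have := hF.2; grind⟩)
      (fun _ _ _ _ _ _ => rfl) p
  have m1 := reducedBetti_union_le k (K := flagComplex (G.deleteEdges {s(v, w)}) S) (L := star)
    (M := flagComplex G S) (N := susp) S (fun F hF => hF.2.1)
    (fun F => by
      rw [hdel, hstar]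
      refine ⟨fun hF => ?_, fun hF => hF.elim And.left And.left⟩
      by_cases h : v ∉ F ∨ w ∉ F
      · exact Or.inl ⟨hF, h⟩
      · simp only [mem_flagComplex, P] at hF ⊢
        grind)
    (fun F => by rw [hdel, hsusp, hstar]; tauto) (p + 1)
  have m2 := reducedBetti_union_le k (K := coneV) (L := coneW)
    (M := susp) (N := flagComplex G (linkVertices G S v w)) S (fun F hF => hF.1.1.2.1)
    (fun F => by rw [hsusp, hcV, hcW]; tauto)
    (fun F => by
      simp only [hcV, hcW, hstar, mem_flagComplex, P, Finset.subset_iff, mem_linkVertices]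
      constructor
      · rintro ⟨h1, h2, h3⟩
        have hvF : v ∉ F := fun h => (h2 h).2.1.ne rfl
        have hwF : w ∉ F := fun h => (h2 h).2.2.ne rfl
        have h4 : (F.Nonempty ∧ (∀ ⦃x⦄, x ∈ F → x ∈ S) ∧ ∀ x ∈ F, ∀ y ∈ F, x ≠ y → G.Adj x y) ∧
            ∀ x ∈ F, (x ≠ v → G.Adj v x) ∧ (x ≠ w → G.Adj w x) :=
          ⟨⟨h1, fun x hx => (h2 hx).1, h3⟩,
            fun x hx => ⟨fun _ => (h2 hx).2.1, fun _ => (h2 hx).2.2⟩⟩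
        exact ⟨⟨h4, hwF⟩, ⟨h4, hvF⟩⟩
      · rintro ⟨⟨⟨⟨h1, h2, h3⟩, h4⟩, hwF⟩, -, hvF⟩
        exact ⟨h1, fun x hx => ⟨h2 hx, (h4 x hx).1 (ne_of_mem_of_not_mem hx hvF),
          (h4 x hx).2 (ne_of_mem_of_not_mem hx hwF)⟩, h3⟩) p
  rw [b2, b3, zero_add, zero_add] at m2
  rw [b1, add_zero] at m1
  exact m1.trans (Nat.add_le_add_left m2 _)

/-! ### Graphs whose neighbourhoods are coloured by cliques -/

section Coloring

variable {V ι : Type*}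

/-- A vertex colouring `c` of `G` such that neighbours of a common vertex with the same colour are
adjacent. In particular each class of `c` induces a disjoint union of cliques. -/
def IsLocalCliqueColoring (G : SimpleGraph V) (c : V → ι) : Prop :=
  ∀ w x y, G.Adj w x → G.Adj w y → c x = c y → x ≠ y → G.Adj x y

/-- The link of `vw` has an edge between the colours of `v` and `w`. -/
def IsFilled (G : SimpleGraph V) (S : Finset V) (c : V → ι) (v w : V) : Prop :=
  ∃ p ∈ linkVertices G S v w, ∃ q ∈ linkVertices G S v w, c p = c v ∧ c q = c w ∧ G.Adj p q

/-- The vertex `y` of the link of `vw` is adjacent to no vertex of the link with the colour of `v`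
or of `w`. -/
def IsIsolatedFrom (G : SimpleGraph V) (S : Finset V) (c : V → ι) (v w y : V) : Prop :=
  y ∈ linkVertices G S v w ∧
    ∀ z ∈ linkVertices G S v w, c z = c v ∨ c z = c w → ¬ G.Adj y z

/-- The link of `vw` has no edge between the colours of `v` and `w`, or it has a vertex that is
isolated from these colours. This holds whenever the link is nonempty and disconnected. -/
def IsSeparating (G : SimpleGraph V) (S : Finset V) (c : V → ι) (v w : V) : Prop :=
  IsFilled G S c v w → ∃ y, IsIsolatedFrom G S c v w y

open Classical in
/-- The edges of `G` in `S` between different colours, as ordered pairs. -/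
noncomputable def bichromaticEdges (G : SimpleGraph V) (S : Finset V) (c : V → ι) :
    Finset (V × V) :=
  {e ∈ S ×ˢ S | G.Adj e.1 e.2 ∧ c e.1 ≠ c e.2}

variable {G : SimpleGraph V} {S : Finset V} {c : V → ι} {v w : V}

theorem mem_bichromaticEdges {e : V × V} :
    e ∈ bichromaticEdges G S c ↔ e.1 ∈ S ∧ e.2 ∈ S ∧ G.Adj e.1 e.2 ∧ c e.1 ≠ c e.2 := by
  simp [bichromaticEdges, and_assoc]

theorem IsLocalCliqueColoring.deleteEdges (h : IsLocalCliqueColoring G c) (hc : c v ≠ c w) :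
    IsLocalCliqueColoring (G.deleteEdges {s(v, w)}) c := by
  intro u x y hx hy hxy hne
  simp only [SimpleGraph.deleteEdges_adj, Set.mem_singleton_iff] at hx hy ⊢
  refine ⟨h u x y hx.1 hy.1 hxy hne, fun he => ?_⟩
  rcases Sym2.eq_iff.1 he with ⟨rfl, rfl⟩ | ⟨rfl, rfl⟩
  · exact hc hxy
  · exact hc hxy.symm

theorem card_bichromaticEdges_deleteEdges_lt (hv : v ∈ S) (hw : w ∈ S) (hvw : G.Adj v w)
    (hc : c v ≠ c w) :
    (bichromaticEdges (G.deleteEdges {s(v, w)}) S c).card < (bichromaticEdges G S c).card := by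
  refine Finset.card_lt_card ((Finset.ssubset_iff_of_subset fun e he => ?_).2 ⟨(v, w), ?_, ?_⟩)
  · rw [mem_bichromaticEdges] at he ⊢
    exact ⟨he.1, he.2.1, (SimpleGraph.deleteEdges_adj.1 he.2.2.1).1, he.2.2.2⟩
  · exact mem_bichromaticEdges.2 ⟨hv, hw, hvw, hc⟩
  · rw [mem_bichromaticEdges]
    simp [SimpleGraph.deleteEdges_adj]

variable (k : Type*) [Field k]

theorem single_sub_single_mem_boundaries_flagComplex {a b : V} (ha : a ∈ S) (hb : b ∈ S)
    (hab : a ≠ b → G.Adj a b) :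
    (Finsupp.single (fun _ => a) 1 - Finsupp.single (fun _ => b) 1 : (Fin 1 → V) →₀ k) ∈
      boundaries k (flagComplex G S) 0 := by
  classical
  refine single_sub_single_mem_boundaries k (mem_flagComplex.2 ⟨by simp, ?_, ?_⟩)
  · grind
  · grind [SimpleGraph.adj_comm]

theorem singleton_mem_flagComplex {a : V} : {a} ∈ flagComplex G S ↔ a ∈ S := by
  rw [mem_flagComplex]
  simp +contextual

theorem reducedBetti_zero_link_le [Fintype ι] (h : IsLocalCliqueColoring G c) :
    reducedBetti k (flagComplex G (linkVertices G S v w)) 0 ≤ Fintype.card ι := by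
  refine reducedBetti_zero_le_card k (linkVertices G S v w) (fun F hF => hF.2.1) c
    fun a b ha hb hab => ?_
  rw [singleton_mem_flagComplex] at ha hb
  exact single_sub_single_mem_boundaries_flagComplex k ha hb
    (h v a b (mem_linkVertices.1 ha).2.1 (mem_linkVertices.1 hb).2.1 hab)

/-- If `vw` is not separating, then its link is connected: the vertices of the link with the colours
of `v` and `w` form two cliques that are joined by the edge `pq`, and each vertex of the link is
adjacent to one of these cliques. -/
theorem reducedBetti_zero_link_eq_zero (h : IsLocalCliqueColoring G c)
    (hs : ¬ IsSeparating G S c v w) :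
    reducedBetti k (flagComplex G (linkVertices G S v w)) 0 = 0 := by
  simp only [IsSeparating, IsIsolatedFrom, not_forall, not_exists, not_and, not_not] at hs
  obtain ⟨⟨p, hp, q, hq, hpv, hqw, hpq⟩, hy⟩ := hs
  have hcol {a b : V} (ha : a ∈ linkVertices G S v w) (hb : b ∈ linkVertices G S v w)
      (hab : c a = c b) : a ≠ b → G.Adj a b :=
    h v a b (mem_linkVertices.1 ha).2.1 (mem_linkVertices.1 hb).2.1 hab
  have hqp := single_sub_single_mem_boundaries_flagComplex k hq hp fun _ => hpq.symm
  have h1 : ∀ z ∈ linkVertices G S v w, c z = c v ∨ c z = c w →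
      (Finsupp.single (fun _ => z) 1 - Finsupp.single (fun _ => p) 1 : (Fin 1 → V) →₀ k) ∈
        boundaries k (flagComplex G (linkVertices G S v w)) 0 := by
    rintro z hz (hzv | hzw)
    · exact single_sub_single_mem_boundaries_flagComplex k hz hp (hcol hz hp (hzv.trans hpv.symm))
    · have h2 := single_sub_single_mem_boundaries_flagComplex k hz hq
        (hcol hz hq (hzw.trans hqw.symm))
      simpa using add_mem h2 hqp
  have h2 : ∀ z ∈ linkVertices G S v w,
      (Finsupp.single (fun _ => z) 1 - Finsupp.single (fun _ => p) 1 : (Fin 1 → V) →₀ k) ∈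
        boundaries k (flagComplex G (linkVertices G S v w)) 0 := by
    intro y hyl
    obtain ⟨z, hz, hzc, hyz⟩ := hy y hyl
    have h3 := single_sub_single_mem_boundaries_flagComplex k hyl hz fun _ => hyz
    simpa using add_mem h3 (h1 z hz hzc)
  refine reducedBetti_zero_eq_zero k fun a b ha hb => ?_
  rw [singleton_mem_flagComplex] at ha hb
  simpa using sub_mem (h2 a ha) (h2 b hb)

/-- Without edges between different colours, the flag complex is a disjoint union of simplices. -/
theorem reducedBetti_flagComplex_eq_zero (h : IsLocalCliqueColoring G c)
    (he : bichromaticEdges G S c = ∅) (p : ℕ) :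
    reducedBetti k (flagComplex G S) (p + 1) = 0 := by
  classical
  have hcol {x y : V} (hx : x ∈ S) (hy : y ∈ S) (hxy : G.Adj x y) : c x = c y := by
    by_contra hne
    have : (x, y) ∈ bichromaticEdges G S c := mem_bichromaticEdges.2 ⟨hx, hy, hxy, hne⟩
    simp [he] at this
  let s : Setoid V :=
    { r := fun x y => x = y ∨ x ∈ S ∧ y ∈ S ∧ G.Adj x y
      iseqv := by
        refine ⟨fun x => Or.inl rfl, fun {x y} hxy => ?_, fun {x y z} hxy hyz => ?_⟩
        · grind [SimpleGraph.adj_comm]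
        · rcases hxy with rfl | ⟨hx, hy, hxy⟩
          · exact hyz
          rcases hyz with rfl | ⟨-, hz, hyz⟩
          · exact Or.inr ⟨hx, hy, hxy⟩
          rcases eq_or_ne x z with rfl | hxz
          · exact Or.inl rfl
          · exact Or.inr ⟨hx, hz, h y x z hxy.symm hyz
              ((hcol hx hy hxy).trans (hcol hy hz hyz)) hxz⟩ }
  let r (x : V) : V := (Quotient.mk s x).out
  have hr (x : V) : r x = x ∨ r x ∈ S ∧ x ∈ S ∧ G.Adj (r x) x := Quotient.mk_out (s := s) x
  have hrr {x y : V} (hx : x ∈ S) (hy : y ∈ S) (hxy : x ≠ y → G.Adj x y) : r x = r y := by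
    have : s x y := by
      by_cases h : x = y
      · exact Or.inl h
      · exact Or.inr ⟨hx, hy, hxy h⟩
    exact congrArg Quotient.out (Quotient.sound this)
  have hface : ∀ F ∈ flagComplex G S, ∀ x ∈ F, ∀ y ∈ F, r x = r y := fun F hF x hx y hy =>
    hrr (hF.2.1 hx) (hF.2.1 hy) (hF.2.2 x hx y hy)
  refine reducedBetti_succ_eq_zero_of_apex k r (fun F hF x hx => ?_) hface p
  have hadj : ∀ y ∈ F, r x = y ∨ r x ∈ S ∧ G.Adj (r x) y := fun y hy => by
    rw [hface F hF x hx y hy]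
    exact (hr y).imp_right fun h => ⟨h.1, h.2.2⟩
  rw [mem_flagComplex] at hF ⊢
  refine ⟨by simp, ?_, ?_⟩
  · have := hadj x hx
    grind
  · grind [SimpleGraph.adj_comm]

theorem reducedBetti_flagComplex_le_mul_card [Fintype ι] (h : IsLocalCliqueColoring G c) :
    reducedBetti k (flagComplex G S) 2 ≤
      Fintype.card ι * (bichromaticEdges G S c).card := by
  induction hn : (bichromaticEdges G S c).card using Nat.strong_induction_on generalizing G with
  | _ n ih =>
    subst hn
    rcases (bichromaticEdges G S c).eq_empty_or_nonempty with he | ⟨⟨v, w⟩, he⟩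
    · rw [reducedBetti_flagComplex_eq_zero k h he]
      exact Nat.zero_le _
    · obtain ⟨hv, hw, hvw, hc⟩ := mem_bichromaticEdges.1 he
      have hlt := card_bichromaticEdges_deleteEdges_lt hv hw hvw hc
      have h1 := ih _ hlt (h.deleteEdges hc) rfl
      have h2 := reducedBetti_flagComplex_le_deleteEdges k hv hw hvw 0
      have h3 := reducedBetti_zero_link_le k (S := S) (v := v) (w := w) h
      calc _ ≤ _ := h2
        _ ≤ Fintype.card ι * (bichromaticEdges (G.deleteEdges {s(v, w)}) S c).card +
              Fintype.card ι := Nat.add_le_add h1 h3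
        _ = Fintype.card ι * ((bichromaticEdges (G.deleteEdges {s(v, w)}) S c).card + 1) := by ring
        _ ≤ _ := Nat.mul_le_mul_left _ hlt

/-- The deletion of bichromatic edges that are not separating does not decrease the second Betti
number, so that it suffices to bound the number of edges in a graph where all of them separate. -/
theorem exists_isSeparating_reducedBetti_le (h : IsLocalCliqueColoring G c) :
    ∃ G' : SimpleGraph V, IsLocalCliqueColoring G' c ∧
      (∀ e ∈ bichromaticEdges G' S c, IsSeparating G' S c e.1 e.2) ∧
      reducedBetti k (flagComplex G S) 2 ≤ reducedBetti k (flagComplex G' S) 2 := by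
  induction hn : (bichromaticEdges G S c).card using Nat.strong_induction_on generalizing G with
  | _ n ih =>
    subst hn
    by_cases hall : ∀ e ∈ bichromaticEdges G S c, IsSeparating G S c e.1 e.2
    · exact ⟨G, h, hall, le_rfl⟩
    · push Not at hall
      obtain ⟨⟨v, w⟩, he, hs⟩ := hall
      obtain ⟨hv, hw, hvw, hc⟩ := mem_bichromaticEdges.1 he
      obtain ⟨G', h1, h2, h3⟩ :=
        ih _ (card_bichromaticEdges_deleteEdges_lt hv hw hvw hc) (h.deleteEdges hc) rfl
      refine ⟨G', h1, h2, ?_⟩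
      have h4 := reducedBetti_flagComplex_le_deleteEdges k hv hw hvw 0
      rw [reducedBetti_zero_link_eq_zero k h hs, add_zero] at h4
      exact h4.trans h3

end Coloring

/-! ### Counting edges and edge-disjoint triangles -/

section Counting

open Finset

theorem card_sq_le_of_forall_not_rectangle {V : Type*} (S : Finset V) (E : Finset (V × V))
    (hE : ∀ e ∈ E, e.1 ∈ S ∧ e.2 ∈ S)
    (h : ∀ v v' w w', v ≠ v' → w ≠ w' → (v, w) ∈ E → (v', w) ∈ E → (v, w') ∈ E → (v', w') ∉ E) :
    #E ^ 2 ≤ 2 * #S ^ 3 := by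
  classical
  have hES : #E ≤ #S ^ 2 := by
    rw [sq, ← card_product]
    exact card_le_card fun e he => mem_product.2 (hE e he)
  -- pairs of edges with the same second endpoint
  let R : Finset ((V × V) × (V × V)) := {x ∈ E ×ˢ E | x.1.2 = x.2.2}
  have hR : #R ≤ 2 * #S ^ 2 := by
    rw [← card_filter_add_card_filter_not (fun x : (V × V) × (V × V) => x.1 = x.2), two_mul]
    refine Nat.add_le_add (le_trans ?_ hES) ?_
    · refine card_le_card_of_injOn Prod.fst (fun x hx => ?_) (fun x hx y hy hxy => ?_)
      · simp only [R, coe_filter, mem_filter, mem_product, Set.mem_ofPred_eq] at hx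
        exact hx.1.1.1
      · simp only [coe_filter, Set.mem_ofPred_eq] at hx hy
        exact Prod.ext hxy (by rw [← hx.2, ← hy.2, hxy])
    · rw [sq, ← card_product]
      refine card_le_card_of_injOn (fun x => (x.1.1, x.2.1)) (fun x hx => ?_)
        (fun x hx y hy hxy => ?_)
      · simp only [R, coe_filter, mem_filter, mem_product, Set.mem_ofPred_eq] at hx
        exact mem_coe.2 (mem_product.2 ⟨(hE _ hx.1.1.1).1, (hE _ hx.1.1.2).1⟩)
      · obtain ⟨⟨a, b⟩, ⟨a', b'⟩⟩ := x
        obtain ⟨⟨u, v⟩, ⟨u', v'⟩⟩ := y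
        simp only [R, coe_filter, mem_filter, mem_product, Set.mem_ofPred_eq,
          Prod.mk.injEq] at hx hy hxy
        obtain ⟨⟨⟨ha, hb⟩, rfl⟩, hne⟩ := hx
        obtain ⟨⟨⟨hu, hv⟩, rfl⟩, -⟩ := hy
        obtain ⟨rfl, rfl⟩ := hxy
        by_contra hbv
        refine h a a' b v (fun h => hne ⟨h, rfl⟩) (fun h => hbv (by rw [h])) ha hb hu hv
  have h1 : #E = ∑ w ∈ S, #{e ∈ E | e.2 = w} :=
    card_eq_sum_card_fiberwise fun e he => (hE e he).2
  have h2 : #R = ∑ w ∈ S, #{e ∈ E | e.2 = w} ^ 2 := by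
    rw [card_eq_sum_card_fiberwise (f := fun x => x.1.2) (t := S)
      (fun x hx => (hE x.1 (mem_product.1 (mem_filter.1 hx).1).1).2)]
    refine sum_congr rfl fun w _ => ?_
    rw [sq, ← card_product]
    congr 1
    ext x
    simp only [mem_filter, mem_product]
    grind
  calc #E ^ 2 ≤ #S * #R := by rw [h1, h2]; exact sq_sum_le_card_mul_sum_sq
    _ ≤ #S * (2 * #S ^ 2) := Nat.mul_le_mul_left _ hR
    _ = 2 * #S ^ 3 := by ring

open SimpleGraph.TripartiteFromTriangles in
/-- The Ruzsa-Szemerédi bound: `n` vertices carry only `o(n²)` edge-disjoint triangles that create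
no further triangle. -/
theorem exists_card_le_of_explicitDisjoint (V : Type*) {ε : ℝ} (hε : 0 < ε) :
    ∃ N : ℕ, ∀ n ≥ N, ∀ (S : Finset V) (T : Finset (V × V × V)), #S ≤ n →
      (∀ t ∈ T, t.1 ∈ S ∧ t.2.1 ∈ S ∧ t.2.2 ∈ S) → ExplicitDisjoint T → NoAccidental T →
      (#T : ℝ) ≤ ε * n ^ 2 := by
  classical
  set B := SimpleGraph.triangleRemovalBound (ε / 9) with hB
  have hB0 : 0 < B := SimpleGraph.triangleRemovalBound_pos (by positivity)
  refine ⟨⌈1 / (B ^ 2 * ε)⌉₊, fun n hn S T hS hT hd ha => ?_⟩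
  by_contra! hlt
  have hSn : (#S : ℝ) ≤ n := by exact_mod_cast hS
  let T' : Finset (S × S × S) := {t | ((t.1 : V), (t.2.1 : V), (t.2.2 : V)) ∈ T}
  have hT' : #T' = #T := by
    refine card_bij (fun t _ => ((t.1 : V), (t.2.1 : V), (t.2.2 : V))) (fun t ht => ?_)
      (fun s _ t _ hst => ?_) (fun t ht => ?_)
    · exact (mem_filter.1 ht).2
    · simp only [Prod.mk.injEq, Subtype.coe_inj] at hst
      exact Prod.ext hst.1 (Prod.ext hst.2.1 hst.2.2)
    · obtain ⟨h1, h2, h3⟩ := hT t ht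
      exact ⟨(⟨t.1, h1⟩, ⟨t.2.1, h2⟩, ⟨t.2.2, h3⟩), by simpa [T'] using ht, rfl⟩
  have hmem (a b c : S) : (a, b, c) ∈ T' ↔ ((a : V), (b : V), (c : V)) ∈ T := by simp [T']
  have hd' : ExplicitDisjoint T' := by
    constructor <;> intro a b c x h1 h2 <;> rw [hmem] at h1 h2
    · exact Subtype.ext (hd.inj₀ h1 h2)
    · exact Subtype.ext (hd.inj₁ h1 h2)
    · exact Subtype.ext (hd.inj₂ h1 h2)
  have ha' : NoAccidental T' := by
    constructor
    intro a a' b b' c c' h1 h2 h3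
    rw [hmem] at h1 h2 h3
    simpa only [Subtype.coe_inj] using ha.eq_or_eq_or_eq h1 h2 h3
  have hinj {a b c c' : V} (h1 : (a, b, c) ∈ T) (h2 : (a, b, c') ∈ T) : c = c' := hd.inj₂ h1 h2
  have hTS : #T ≤ #S ^ 2 := by
    rw [sq, ← card_product]
    refine card_le_card_of_injOn (fun t => (t.1, t.2.1))
      (fun t ht => mem_coe.2 (mem_product.2 ⟨(hT t ht).1, (hT t ht).2.1⟩)) ?_
    rintro ⟨a, b, c⟩ hs ⟨a', b', c'⟩ ht hst
    obtain ⟨rfl, rfl⟩ := Prod.mk.inj hst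
    rw [hinj hs ht]
  have hTS' : (#T : ℝ) ≤ (#S : ℝ) ^ 2 := by exact_mod_cast hTS
  have hfar : (graph T').FarFromTriangleFree (ε / 9) := by
    refine farFromTriangleFree (t := T') ?_
    rw [hT', Fintype.card_coe]
    push_cast
    calc ε / 9 * ((#S : ℝ) + #S + #S) ^ 2 = ε * (#S : ℝ) ^ 2 := by ring
      _ ≤ ε * n ^ 2 := by gcongr
      _ ≤ #T := hlt.le
  have hcl := hfar.le_card_cliqueFinset
  rw [card_triangles, hT', ← hB] at hcl
  simp only [Fintype.card_sum, Fintype.card_coe] at hcl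
  push_cast at hcl
  have hpos : (0 : ℝ) < #S := by
    by_contra! h0
    have h0 : (#S : ℝ) = 0 := le_antisymm h0 (by positivity)
    rw [h0] at hTS'
    have : 0 ≤ ε * (n : ℝ) ^ 2 := by positivity
    nlinarith
  have hS1 : B * #S ≤ 1 := by
    have : (B * #S) * (#S : ℝ) ^ 2 ≤ 1 * (#S : ℝ) ^ 2 := by
      have : 0 ≤ B * (#S : ℝ) ^ 3 := by positivity
      nlinarith
    exact le_of_mul_le_mul_right this (by positivity)
  have hn1 : (1 : ℝ) ≤ n := by
    have : (1 : ℝ) ≤ #S := by exact_mod_cast hpos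
    linarith
  have hn2 : 1 / (B ^ 2 * ε) ≤ (n : ℝ) := Nat.ceil_le.1 hn
  rw [div_le_iff₀ (by positivity)] at hn2
  have h3 : B ^ 2 * (#S : ℝ) ^ 2 ≤ 1 := by
    rw [← mul_pow]; exact pow_le_one₀ (by positivity) hS1
  have h4 : B ^ 2 * (ε * (n : ℝ) ^ 2) < 1 :=
    (mul_lt_mul_of_pos_left (hlt.trans_le hTS') (by positivity)).trans_le h3
  have h5 : n * (B ^ 2 * ε) * 1 ≤ n * (B ^ 2 * ε) * n := by gcongr
  nlinarith

end Counting

section Coloring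

open Finset

variable {V ι : Type*} {G : SimpleGraph V} {S : Finset V} {c : V → ι}

/-- An edge of `E` on a four-cycle of edges of `E` that alternates between two colours would have an
edge between these colours in its link, so `E` contains no such four-cycle. -/
theorem card_sq_le_of_forall_not_isFilled (h : IsLocalCliqueColoring G c) {E : Finset (V × V)}
    (hE : E ⊆ bichromaticEdges G S c) {i j : ι} (hi : ∀ e ∈ E, c e.1 = i) (hj : ∀ e ∈ E, c e.2 = j)
    (hE' : ∀ e ∈ E, ¬ IsFilled G S c e.1 e.2) :
    #E ^ 2 ≤ 2 * #S ^ 3 := by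
  refine card_sq_le_of_forall_not_rectangle S E
    (fun e he => ⟨(mem_bichromaticEdges.1 (hE he)).1, (mem_bichromaticEdges.1 (hE he)).2.1⟩) ?_
  intro v v' w w' hv hw h1 h2 h3 h4
  obtain ⟨v1, w1, a1, -⟩ := mem_bichromaticEdges.1 (hE h1)
  obtain ⟨v2, -, a2, -⟩ := mem_bichromaticEdges.1 (hE h2)
  obtain ⟨-, w3, a3, -⟩ := mem_bichromaticEdges.1 (hE h3)
  obtain ⟨-, -, a4, -⟩ := mem_bichromaticEdges.1 (hE h4)
  have cv : c v = c v' := (hi _ h1).trans (hi _ h2).symm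
  have cw : c w = c w' := (hj _ h1).trans (hj _ h3).symm
  exact hE' _ h1 ⟨v', mem_linkVertices.2 ⟨v2, h w v v' a1.symm a2.symm cv hv, a2.symm⟩,
    w', mem_linkVertices.2 ⟨w3, a3, h v w w' a1 a3 cw hw⟩, cv.symm, cw.symm, a4⟩

open SimpleGraph.TripartiteFromTriangles in
/-- If the link of every edge `vw` of `E` has a vertex `y` that is isolated from the colours of `v`
and `w`, then any edge of such a triangle `vwy`
determines the triangle, so that the Ruzsa-Szemerédi bound applies. -/
theorem exists_card_le_of_isolated (V ι : Type*) {ε : ℝ} (hε : 0 < ε) :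
    ∃ N : ℕ, ∀ n ≥ N, ∀ (G : SimpleGraph V) (S : Finset V) (c : V → ι), #S ≤ n →
      IsLocalCliqueColoring G c → ∀ (E : Finset (V × V)), E ⊆ bichromaticEdges G S c →
      ∀ (i j : ι) (y : V × V → V),
      (∀ e ∈ E, c e.1 = i ∧ c e.2 = j) →
      (∀ e ∈ E, IsIsolatedFrom G S c e.1 e.2 (y e)) →
      (#E : ℝ) ≤ ε * n ^ 2 := by
  classical
  obtain ⟨N, hN⟩ := exists_card_le_of_explicitDisjoint V hε
  refine ⟨N, fun n hn G S c hS h E hE i j y hc hy => ?_⟩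
  let T : Finset (V × V × V) := E.image fun e => (e.1, e.2, y e)
  have hcard : #T = #E := by
    refine card_image_of_injective _ fun e e' hee => ?_
    simp only [Prod.mk.injEq] at hee
    exact Prod.ext hee.1 hee.2.1
  have hT {v w x : V} (ht : (v, w, x) ∈ T) : (v, w) ∈ E ∧ x = y (v, w) := by
    obtain ⟨⟨v', w'⟩, he, hee⟩ := mem_image.1 ht
    simp only [Prod.mk.injEq] at hee
    obtain ⟨rfl, rfl, rfl⟩ := hee
    exact ⟨he, rfl⟩
  have hadj {v w x : V} (ht : (v, w, x) ∈ T) :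
      (v ∈ S ∧ w ∈ S ∧ x ∈ S) ∧ (G.Adj v w ∧ G.Adj v x ∧ G.Adj w x) ∧ c v = i ∧ c w = j := by
    obtain ⟨he, rfl⟩ := hT ht
    obtain ⟨hv, hw, hvw, -⟩ := mem_bichromaticEdges.1 (hE he)
    obtain ⟨hx, hvx, hwx⟩ := mem_linkVertices.1 (hy _ he).1
    exact ⟨⟨hv, hw, hx⟩, ⟨hvw, hvx, hwx⟩, (hc _ he).1, (hc _ he).2⟩
  -- the edge `wx` determines `v`
  have hfst {v w x v' : V} (ht : (v, w, x) ∈ T) (hv' : v' ∈ S) (hcv : c v' = i)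
      (hw : G.Adj v' w) (hx : G.Adj v' x) : v' = v := by
    by_contra hne
    obtain ⟨-, ⟨hvw, hvx, hwx⟩, hv, -⟩ := hadj ht
    obtain ⟨he, rfl⟩ := hT ht
    exact (hy _ he).2 v' (mem_linkVertices.2
      ⟨hv', h w v v' hvw.symm hw.symm (hv.trans hcv.symm) (Ne.symm hne), hw.symm⟩)
      (Or.inl (hcv.trans hv.symm)) hx.symm
  -- the edge `vx` determines `w`
  have hsnd {v w x w' : V} (ht : (v, w, x) ∈ T) (hw' : w' ∈ S) (hcw : c w' = j)
      (hv : G.Adj v w') (hx : G.Adj w' x) : w' = w := by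
    by_contra hne
    obtain ⟨-, ⟨hvw, hvx, hwx⟩, -, hw⟩ := hadj ht
    obtain ⟨he, rfl⟩ := hT ht
    exact (hy _ he).2 w' (mem_linkVertices.2
      ⟨hw', hv, h v w w' hvw hv (hw.trans hcw.symm) (Ne.symm hne)⟩)
      (Or.inr (hcw.trans hw.symm)) hx.symm
  rw [← hcard]
  refine hN n hn S T hS (fun t ht => (hadj ht).1) ⟨?_, ?_, ?_⟩ ⟨?_⟩
  · intro a b x a' h1 h2
    obtain ⟨⟨hs, -, -⟩, ⟨hab, hax, -⟩, hca, -⟩ := hadj h1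
    exact hfst h2 hs hca hab hax
  · intro a b x b' h1 h2
    obtain ⟨⟨-, hs, -⟩, ⟨hab, -, hbx⟩, -, hcb⟩ := hadj h1
    exact hsnd h2 hs hcb hab hbx
  · intro a b x x' h1 h2
    rw [(hT h1).2, (hT h2).2]
  · intro a a' b b' x x' h1 h2 h3
    obtain ⟨⟨hs, -, -⟩, ⟨hab, -, -⟩, hca, -⟩ := hadj h3
    exact Or.inl (hfst h1 hs hca hab (hadj h2).2.1.2.1)

theorem exists_card_le_of_isFilled_imp (V ι : Type*) {ε : ℝ} (hε : 0 < ε) :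
    ∃ N : ℕ, ∀ n ≥ N, ∀ (G : SimpleGraph V) (S : Finset V) (c : V → ι), #S ≤ n →
      IsLocalCliqueColoring G c → ∀ (E : Finset (V × V)), E ⊆ bichromaticEdges G S c →
      ∀ (i j : ι) (y : V × V → V),
      (∀ e ∈ E, c e.1 = i ∧ c e.2 = j) →
      (∀ e ∈ E, IsFilled G S c e.1 e.2 → IsIsolatedFrom G S c e.1 e.2 (y e)) →
      (#E : ℝ) ≤ ε * n ^ 2 := by
  classical
  obtain ⟨N, hN⟩ := exists_card_le_of_isolated V ι (half_pos hε)
  refine ⟨max N ⌈2 / (ε / 2) ^ 2⌉₊, fun n hn G S c hS h E hE i j y hc hy => ?_⟩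
  have hSn : (#S : ℝ) ≤ n := by exact_mod_cast hS
  have h1 : (#{e ∈ E | IsFilled G S c e.1 e.2} : ℝ) ≤ ε / 2 * n ^ 2 :=
    hN n (le_of_max_le_left hn) G S c hS h _ ((filter_subset _ _).trans hE) i j y
      (fun e he => hc e (mem_filter.1 he).1)
      (fun e he => hy e (mem_filter.1 he).1 (mem_filter.1 he).2)
  have h2 : (#{e ∈ E | ¬ IsFilled G S c e.1 e.2} : ℝ) ≤ ε / 2 * n ^ 2 := by
    have h3 := card_sq_le_of_forall_not_isFilled h (S := S)
      (E := {e ∈ E | ¬ IsFilled G S c e.1 e.2})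
      ((filter_subset _ _).trans hE) (i := i) (j := j)
      (fun e he => (hc e (mem_filter.1 he).1).1) (fun e he => (hc e (mem_filter.1 he).1).2)
      (fun e he => (mem_filter.1 he).2)
    have h4 : (#{e ∈ E | ¬ IsFilled G S c e.1 e.2} : ℝ) ^ 2 ≤ 2 * (#S : ℝ) ^ 3 := by
      exact_mod_cast h3
    have hn2 : 2 / (ε / 2) ^ 2 ≤ (n : ℝ) := Nat.ceil_le.1 (le_of_max_le_right hn)
    rw [div_le_iff₀ (by positivity)] at hn2
    refine le_of_sq_le_sq ?_ (by positivity)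
    calc _ ≤ 2 * (#S : ℝ) ^ 3 := h4
      _ ≤ 2 * (n : ℝ) ^ 3 := by gcongr
      _ ≤ (n * (ε / 2) ^ 2) * (n : ℝ) ^ 3 := by gcongr
      _ = (ε / 2 * n ^ 2) ^ 2 := by ring
  have h3 : (#E : ℝ) = #{e ∈ E | IsFilled G S c e.1 e.2} + #{e ∈ E | ¬ IsFilled G S c e.1 e.2} := by
    exact_mod_cast (card_filter_add_card_filter_not (s := E) (fun e => IsFilled G S c e.1 e.2)).symm
  linarith

theorem exists_card_bichromaticEdges_le (V ι : Type*) [Fintype ι] {ε : ℝ} (hε : 0 < ε) :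
    ∃ N : ℕ, ∀ n ≥ N, ∀ (G : SimpleGraph V) (S : Finset V) (c : V → ι), #S ≤ n →
      IsLocalCliqueColoring G c →
      (∀ e ∈ bichromaticEdges G S c, IsSeparating G S c e.1 e.2) →
      (#(bichromaticEdges G S c) : ℝ) ≤ ε * n ^ 2 := by
  classical
  set m : ℝ := ((Fintype.card (ι × ι) : ℕ) : ℝ) with hm
  have hm0 : 0 ≤ m := by positivity
  obtain ⟨N, hN⟩ := exists_card_le_of_isFilled_imp V ι (ε := ε / (m + 1)) (by positivity)
  refine ⟨N, fun n hn G S c hS h hsep => ?_⟩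
  let y (e : V × V) : V := if he : ∃ y, IsIsolatedFrom G S c e.1 e.2 y then he.choose else e.1
  have hy (e) (he : e ∈ bichromaticEdges G S c) (hf : IsFilled G S c e.1 e.2) :
      IsIsolatedFrom G S c e.1 e.2 (y e) := by
    have hex := hsep e he hf
    simp only [y, dif_pos hex]
    exact hex.choose_spec
  have hfiber (f : ι × ι) :
      (#{e ∈ bichromaticEdges G S c | (c e.1, c e.2) = f} : ℝ) ≤ ε / (m + 1) * n ^ 2 := by
    refine hN n hn G S c hS h _ (filter_subset _ _) f.1 f.2 y (fun e he => ?_)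
      (fun e he => hy e (mem_filter.1 he).1)
    have hef := (mem_filter.1 he).2
    exact ⟨congrArg Prod.fst hef, congrArg Prod.snd hef⟩
  have hsum : #(bichromaticEdges G S c) = ∑ f : ι × ι,
      #{e ∈ bichromaticEdges G S c | (c e.1, c e.2) = f} :=
    card_eq_sum_card_fiberwise fun e _ => mem_coe.2 (mem_univ _)
  rw [hsum]
  push_cast
  calc _ ≤ ∑ _f : ι × ι, ε / (m + 1) * (n : ℝ) ^ 2 := sum_le_sum fun f _ => hfiber f
    _ = m * (ε / (m + 1)) * (n : ℝ) ^ 2 := by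
      rw [sum_const, nsmul_eq_mul, card_univ, ← hm]; ring
    _ ≤ (m + 1) * (ε / (m + 1)) * (n : ℝ) ^ 2 := by gcongr; linarith
    _ = ε * n ^ 2 := by field_simp

end Coloring

/-! ### Vietoris-Rips complexes of points in Euclidean space -/

/-- The graph that joins distinct points at distance at most `1`. -/
def unitDistanceGraph (E : Type*) [MetricSpace E] : SimpleGraph E where
  Adj x y := x ≠ y ∧ dist x y ≤ 1
  symm := ⟨fun x y h => ⟨h.1.symm, by rw [dist_comm]; exact h.2⟩⟩
  loopless := ⟨fun _ h => h.1 rfl⟩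

theorem ripsComplex_eq_flagComplex {E : Type*} [MetricSpace E] (S : Finset E) :
    ripsComplex 1 S = flagComplex (unitDistanceGraph E) S := by
  refine PreAbstractSimplicialComplex.ext (Set.ext fun F => ?_)
  refine and_congr_right fun _ => and_congr_right fun _ => ⟨fun h x hx y hy hxy => ⟨hxy, ?_⟩,
    fun h => Metric.diam_le_of_forall_dist_le zero_le_one fun x hx y hy => ?_⟩
  · exact (Metric.dist_le_diam_of_mem F.finite_toSet.isBounded hx hy).trans h
  · rcases eq_or_ne x y with rfl | hxy
    · simp
    · exact (h x hx y hy hxy).2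

/-- The index modulo `2 * d + 3` of the cube of side `1 / (d + 1)` that contains the point. -/
noncomputable def cubeColoring (d : ℕ) (x : EuclideanSpace ℝ (Fin d)) : Fin d → ZMod (2 * d + 3) :=
  fun i => (⌊x i * (d + 1)⌋ : ℤ)

/-- Points with a common neighbour have distance at most `2`, so their cube indices differ by less
than `2 * d + 3`. If they have the same colour, they thus lie in the same cube, whose diameter is at
most `1`. -/
theorem isLocalCliqueColoring_cubeColoring (d : ℕ) :
    IsLocalCliqueColoring (unitDistanceGraph (EuclideanSpace ℝ (Fin d))) (cubeColoring d) := by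
  intro w x y hx hy hxy hne
  refine ⟨hne, ?_⟩
  have hd : dist x y ≤ 2 := by
    have := dist_triangle_left x y w
    linarith [hx.2, hy.2]
  have hcoord (i : Fin d) : (x i - y i) ^ 2 ≤ (1 / (d + 1 : ℝ)) ^ 2 := by
    have h1 : |x i - y i| ≤ 2 := by
      refine le_trans ?_ hd
      rw [dist_eq_norm]
      exact PiLp.norm_apply_le (x - y) i
    have h2 := congrFun hxy i
    simp only [cubeColoring] at h2
    rw [ZMod.intCast_eq_intCast_iff_dvd_sub] at h2
    have hfl : ⌊y i * (d + 1)⌋ - ⌊x i * (d + 1)⌋ = 0 := by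
      refine Int.eq_zero_of_abs_lt_dvd h2 ?_
      have a1 := Int.floor_le (x i * (d + 1))
      have a2 := Int.lt_floor_add_one (x i * (d + 1))
      have b1 := Int.floor_le (y i * (d + 1))
      have b2 := Int.lt_floor_add_one (y i * (d + 1))
      have hd0 : (0 : ℝ) ≤ d + 1 := by positivity
      obtain ⟨c1, c2⟩ := abs_le.1 h1
      have e1 := mul_le_mul_of_nonneg_right c1 hd0
      have e2 := mul_le_mul_of_nonneg_right c2 hd0
      have : |((⌊y i * (d + 1)⌋ - ⌊x i * (d + 1)⌋ : ℤ) : ℝ)| < ((2 * d + 3 : ℕ) : ℤ) := by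
        push_cast
        rw [abs_lt]
        constructor <;> linarith
      exact_mod_cast this
    have h3 := Int.abs_sub_lt_one_of_floor_eq_floor (sub_eq_zero.1 hfl).symm
    rw [← sub_mul, abs_mul, abs_of_pos (by positivity : (0 : ℝ) < d + 1)] at h3
    rw [← sq_abs]
    refine pow_le_pow_left₀ (abs_nonneg _) ?_ 2
    rw [le_div_iff₀ (by positivity)]
    exact h3.le
  rw [EuclideanSpace.dist_eq, Real.sqrt_le_iff, one_pow]
  refine ⟨zero_le_one, ?_⟩
  calc ∑ i, dist (x i) (y i) ^ 2 ≤ ∑ _i : Fin d, (1 / (d + 1 : ℝ)) ^ 2 :=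
        Finset.sum_le_sum fun i _ => by rw [Real.dist_eq, sq_abs]; exact hcoord i
    _ = d / (d + 1 : ℝ) ^ 2 := by simp [div_eq_mul_inv]
    _ ≤ 1 := by
      rw [div_le_one (by positivity)]
      nlinarith [(Nat.cast_nonneg d : (0 : ℝ) ≤ d)]

theorem mainTheorem3 (d : ℕ) (δ : ℝ) (hδ : 0 < δ) :
    ∃ N : ℕ, ∀ n : ℕ, N ≤ n → ∀ (k : Type*) [Field k],
      (maxRipsBetti k 2 d n : ℝ) < δ * (n : ℝ) ^ 2 := by
  set m : ℝ := ((Fintype.card (Fin d → ZMod (2 * d + 3)) : ℕ) : ℝ) with hm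
  have hm0 : 0 ≤ m := by positivity
  obtain ⟨N, hN⟩ := exists_card_bichromaticEdges_le (EuclideanSpace ℝ (Fin d))
    (Fin d → ZMod (2 * d + 3)) (ε := δ / (m + 1)) (by positivity)
  refine ⟨max N 1, fun n hn k _ => ?_⟩
  obtain ⟨S, hS, hb⟩ := (isGreatest_maxRipsBetti k 2 d n).1
  obtain ⟨G, hG, hsep, hle⟩ := exists_isSeparating_reducedBetti_le k (S := S)
    (isLocalCliqueColoring_cubeColoring d)
  have h1 := hle.trans (reducedBetti_flagComplex_le_mul_card k hG)
  rw [← ripsComplex_eq_flagComplex, hb] at h1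
  have h2 := hN n (le_of_max_le_left hn) G S _ hS hG hsep
  have h3 : (maxRipsBetti k 2 d n : ℝ) ≤ m * (bichromaticEdges G S (cubeColoring d)).card := by
    rw [hm]; exact_mod_cast h1
  have hn1 : (0 : ℝ) < n := by exact_mod_cast le_of_max_le_right hn
  calc _ ≤ m * (bichromaticEdges G S (cubeColoring d)).card := h3
    _ ≤ m * (δ / (m + 1) * n ^ 2) := by gcongr
    _ < (m + 1) * (δ / (m + 1) * n ^ 2) := by gcongr; linarith
    _ = δ * n ^ 2 := by field_simp
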